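/- A metric space $X$ is *straight* if, whenever $X$ is the union of finitely many closed sets, a continuous function $f\colon X\to\mathbb{R}$ is uniformly continuous if and only if its restriction to each of these closed sets is uniformly continuous. It is *uniformly locally connected* (ULC) if for every $\varepsilon>0$ there is $\delta>0$ such that any two points at distance $<\delta$ lie in a connected set of diameter $<\varepsilon$. It is *precompact* if it is totally bounded. Let $X_1,\dots,X_n$ be non-empty metric spaces, and let $X=\prod_{i=1}^n X_i$ carry the metric $d(x,y)=\sum_{i=1}^n d_i(x_i,y_i)$. Then $X$ is straight if and only if all the spaces $X_i$ are straight and at least one of the following conditions holds: (a) all spaces $X_i$ are precompact; (b) all spaces $X_i$ are ULC; (c) there is an index $j$ such that $X_i$ is both precompact and ULC for every $i\neq j$. -/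

import Mathlib

/-- A metric space `X` is *straight* if, whenever `X` is the union of finitely many closed sets,
a continuous function `f : X → ℝ` is uniformly continuous if and only if its restriction to each
of the closed sets is uniformly continuous. -/
def IsStraight (X : Type*) [MetricSpace X] : Prop :=
  ∀ (m : ℕ) (C : Fin m → Set X), (∀ k, IsClosed (C k)) → (⋃ k, C k) = Set.univ →
    ∀ f : C(X, ℝ), UniformContinuous f ↔ ∀ k, UniformContinuousOn f (C k)

/-- A metric space `X` is *uniformly locally connected* if for every `ε > 0` there is `δ > 0` such
that any two points at distance `< δ` lie in a connected set of diameter `< ε`. The diameter is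
the extended one, so that unbounded sets have infinite diameter. -/
def IsULC (X : Type*) [MetricSpace X] : Prop :=
  ∀ ε : ℝ, 0 < ε → ∃ δ : ℝ, 0 < δ ∧ ∀ x y : X, dist x y < δ →
    ∃ C : Set X, IsConnected C ∧ x ∈ C ∧ y ∈ C ∧ Metric.ediam C < ENNReal.ofReal ε

/-- A metric space is *precompact* if it is totally bounded. -/
def IsPrecompactSpace (X : Type*) [MetricSpace X] : Prop :=
  TotallyBounded (Set.univ : Set X)

/-!
Straightness splits into two independent properties: every trace on `X` of the neighbourhood filter
of a point of the completion is tight, and points that are uniformly close together but separated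
in balls of a fixed radius accumulate only along Cauchy filters. If either property fails, one
builds on disjoint open sets a function which is uniformly continuous on both of two closed sets
covering `X` but not on `X`. Conversely, if a function is uniformly continuous on each of finitely
many closed sets covering `X`, then its image of a small set of diameter less than some `δ` leaves
a gap in every interval of length `ε`, so that points at distance at least `ε` in the image are
separated in balls of a fixed radius; pairs of such points that get close together cluster at a
point of the completion, where tightness forces the function to converge.

Tightness passes to products. The second property concerns pairs of coordinates: a product of balls
separates two points only if one coordinate does, and if the `j`-th factor is not uniformly locally
connected, then separated pairs there can be combined with an arbitrary ultrafilter on the `i`-th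
factor, which must therefore be Cauchy.
-/

open Filter Set
open UniformSpace (Completion)
open scoped ENNReal Topology Uniformity

theorem exists_eq_pure_of_isCountablyGenerated {α : Type*} (𝒰 : Ultrafilter α)
    [(𝒰 : Filter α).IsCountablyGenerated] : ∃ a, 𝒰 = pure a := by
  refine 𝒰.le_cofinite_or_eq_pure.resolve_left fun hcof => ?_
  obtain ⟨u, hu⟩ := (𝒰 : Filter α).exists_seq_tendsto
  have hinf : (range u).Infinite := fun hfin => by
    obtain ⟨n, hn⟩ := (hu.eventually_mem (hcof hfin.compl_mem_cofinite)).exists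
    exact hn ⟨n, rfl⟩
  let v := hinf.natEmbedding
  choose φ hφ using fun k => (v k).2
  have huφ : Function.Injective (u ∘ φ) := fun k l hkl => v.injective (Subtype.ext (by
    rw [← hφ, ← hφ]; exact hkl))
  have hlim : Tendsto (u ∘ φ) atTop 𝒰 := hu.comp huφ.of_comp.nat_tendsto_atTop
  rcases 𝒰.mem_or_compl_mem (range fun k => u (φ (2 * k))) with hS | hS
  · obtain ⟨K, hK⟩ := eventually_atTop.1 (hlim hS)
    obtain ⟨l, hl⟩ := hK (2 * K + 1) (by lia)
    have : 2 * l = 2 * K + 1 := huφ hl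
    lia
  · obtain ⟨K, hK⟩ := eventually_atTop.1 (hlim hS)
    exact hK (2 * K) (by lia) ⟨K, rfl⟩

/-- A filter is *tight* if it has a basis of open sets and no pair of disjoint open sets splits it.
Neighbourhood filters are tight. The traces on a space of the neighbourhood filters of its
completion are tight exactly when the space is tightly embedded in its completion. -/
structure IsTight {X : Type*} [TopologicalSpace X] (F : Filter X) : Prop where
  interior_mem : ∀ s ∈ F, interior s ∈ F
  mem_or_mem : ∀ U V : Set X, IsOpen U → IsOpen V → Disjoint U V → U ∪ V ∈ F → U ∈ F ∨ V ∈ F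

section Tight

variable {X Y : Type*} [TopologicalSpace X] [TopologicalSpace Y] {F : Filter X} {G : Filter Y}

theorem isTight_nhds (x : X) : IsTight (𝓝 x) where
  interior_mem _ := interior_mem_nhds.2
  mem_or_mem _ _ hU hV _ hUV := (mem_of_mem_nhds hUV).imp hU.mem_nhds hV.mem_nhds

theorem IsTight.comap_homeomorph (hG : IsTight G) (e : X ≃ₜ Y) : IsTight (comap e G) := by
  have hmem (s : Set X) : s ∈ comap e G ↔ e.symm ⁻¹' s ∈ G := by
    rw [show comap e G = map e.symm G from (map_equiv_symm e.toEquiv G).symm, mem_map]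
  refine ⟨fun s hs => ?_, fun U V hU hV hd hUV => ?_⟩
  · rw [hmem, e.symm.preimage_interior]
    exact hG.interior_mem _ ((hmem s).1 hs)
  · rw [hmem, hmem]
    exact hG.mem_or_mem _ _ (hU.preimage e.symm.continuous) (hV.preimage e.symm.continuous)
      (hd.preimage _) ((hmem _).1 hUV)

theorem IsTight.exists_eventually_eq [G.NeBot] [G.IsCountablyGenerated] (hG : IsTight G)
    {α : Type*} {T : Y → α} (hT : ∀ᶠ y in G, ∀ᶠ y' in 𝓝 y, T y' = T y) :
    ∃ a, ∀ᶠ y in G, T y = a := by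
  have hultra (S : Set α) : Sᶜ ∉ map T G ↔ S ∈ map T G := by
    refine ⟨fun hS => ?_, compl_notMem⟩
    have hd : Disjoint (interior (T ⁻¹' S)) (interior (T ⁻¹' Sᶜ)) :=
      (disjoint_compl_right (a := T ⁻¹' S)).mono interior_subset interior_subset
    have hcover : interior (T ⁻¹' S) ∪ interior (T ⁻¹' Sᶜ) ∈ G := by
      filter_upwards [hT] with y hy
      refine (em (T y ∈ S)).imp (fun hyS => ?_) (fun hyS => ?_) <;>
        exact mem_interior_iff_mem_nhds.2 (hy.mono fun y' h => by simpa [h] using hyS)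
    rcases hG.mem_or_mem _ _ isOpen_interior isOpen_interior hd hcover with h | h
    · exact mem_map.2 (mem_of_superset h interior_subset)
    · exact absurd (mem_map.2 (mem_of_superset h interior_subset)) hS
  -- `map T G` is a countably generated ultrafilter, so it is principal.
  let 𝒰 : Ultrafilter α := .ofComplNotMemIff (map T G) hultra
  have : (𝒰 : Filter α).IsCountablyGenerated := inferInstanceAs (map T G).IsCountablyGenerated
  obtain ⟨a, ha⟩ := exists_eq_pure_of_isCountablyGenerated 𝒰
  exact ⟨a, show {a} ∈ 𝒰 from ha ▸ rfl⟩

theorem eventually_forall_prodMk_mem_iff {U V : Set (X × Y)} (hU : IsOpen U) (hV : IsOpen V)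
    (hd : Disjoint U V) {x : ℕ → X} (hx : Tendsto x atTop F) {y : Y}
    (hxy : ∀ k, (x k, y) ∈ U ∪ V) (hUy : U ∈ F ×ˢ 𝓝 y) :
    ∀ᶠ y' in 𝓝 y, ∀ k, (x k, y') ∈ V ↔ (x k, y) ∈ V := by
  obtain ⟨A, hA, W, hW, hAW⟩ := mem_prod_iff.1 hUy
  obtain ⟨K, hK⟩ := eventually_atTop.1 (hx hA)
  have hlarge : ∀ y' ∈ W, ∀ k ≥ K, (x k, y') ∉ V := fun y' hy' k hk =>
    disjoint_left.1 hd (hAW (mk_mem_prod (hK k hk) hy'))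
  have hsmall : ∀ᶠ y' in 𝓝 y, ∀ k ∈ Iio K, (x k, y') ∈ V ↔ (x k, y) ∈ V := by
    refine (eventually_all_finite (finite_Iio K)).2 fun k _ => ?_
    have hc : ContinuousAt (fun y' : Y => (x k, y')) y := by fun_prop
    rcases hxy k with h | h
    · filter_upwards [hc.eventually (hU.mem_nhds h)] with y' hy'
      exact iff_of_false (disjoint_left.1 hd hy') (disjoint_left.1 hd h)
    · filter_upwards [hc.eventually (hV.mem_nhds h)] with y' hy'
      exact iff_of_true hy' h
  filter_upwards [hW, hsmall] with y' hy' hk k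
  rcases lt_or_ge k K with hkK | hkK
  · exact hk k hkK
  · exact iff_of_false (hlarge y' hy' k hkK) (hlarge y (mem_of_mem_nhds hW) k hkK)

theorem IsTight.mem_prod_of_eventually_mem [F.IsCountablyGenerated] [G.NeBot]
    [G.IsCountablyGenerated] (hG : IsTight G) {U V : Set (X × Y)} (hU : IsOpen U) (hV : IsOpen V)
    (hd : Disjoint U V) (hUV : U ∪ V ∈ F ×ˢ G) (hl : ∀ᶠ y in G, U ∈ F ×ˢ 𝓝 y) :
    U ∈ F ×ˢ G := by
  by_contra hn
  obtain ⟨A, hA, B, hB, hAB⟩ := mem_prod_iff.1 hUV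
  have hfr : ∃ᶠ q in F ×ˢ G, q ∉ U ∧ q ∈ A ×ˢ B :=
    Frequently.and_eventually (fun h => hn (h.mono fun _ => not_not.1)) (prod_mem_prod hA hB)
  obtain ⟨q, hq, hqU⟩ := exists_seq_forall_of_frequently hfr
  have hqF : Tendsto (fun k => (q k).1) atTop F := tendsto_fst.comp hq
  have hqG : Tendsto (fun k => (q k).2) atTop G := tendsto_snd.comp hq
  have hqV (k : ℕ) : q k ∈ V := (hAB (hqU k).2).resolve_left (hqU k).1
  -- The set of `k` with `((q k).1, y) ∈ V` is locally constant in `y`, hence constant along `G`.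
  obtain ⟨T, hT⟩ : ∃ T, ∀ᶠ y in G, {k | ((q k).1, y) ∈ V} = T := by
    refine hG.exists_eventually_eq ?_
    filter_upwards [hl, hB] with y hy hyB
    refine (eventually_forall_prodMk_mem_iff hU hV hd hqF (fun k => ?_) hy).mono fun _ => Set.ext
    exact hAB (mk_mem_prod (hqU k).2.1 hyB)
  obtain ⟨y, hy, hyT⟩ := (hl.and hT).exists
  have hyU : ∀ᶠ k in atTop, ((q k).1, y) ∈ U := hqF.prodMk tendsto_const_nhds hy
  obtain ⟨k, hkU, hkT⟩ := (hyU.and (hqG.eventually hT)).exists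
  have hkV : k ∈ {k | ((q k).1, y) ∈ V} := by
    rw [hyT, ← hkT]
    exact hqV k
  exact disjoint_left.1 hd hkU hkV

theorem isOpen_setOf_mem_prod_nhds {α : Type*} (H : Filter α) (W : Set (α × Y)) :
    IsOpen {y | W ∈ H ×ˢ 𝓝 y} := by
  refine isOpen_iff_mem_nhds.2 fun y hy => ?_
  obtain ⟨A, hA, B, hB, hAB⟩ := mem_prod_iff.1 hy
  filter_upwards [eventually_mem_nhds_iff.2 hB] with y' hy'
  exact mem_of_superset (prod_mem_prod hA hy') hAB

theorem IsTight.prod_of_prod_nhds [F.NeBot] [F.IsCountablyGenerated] [G.NeBot]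
    [G.IsCountablyGenerated] (hF : ∀ s ∈ F, interior s ∈ F) (hG : IsTight G)
    (hFG : ∀ y : Y, IsTight (F ×ˢ 𝓝 y)) : IsTight (F ×ˢ G) where
  interior_mem s hs := by
    obtain ⟨A, hA, B, hB, hAB⟩ := mem_prod_iff.1 hs
    refine mem_of_superset (prod_mem_prod (hF A hA) (hG.interior_mem B hB)) ?_
    rw [← interior_prod_eq]
    exact interior_mono hAB
  mem_or_mem U V hU hV hd hUV := by
    have hdis : Disjoint {y | U ∈ F ×ˢ 𝓝 y} {y | V ∈ F ×ˢ 𝓝 y} :=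
      disjoint_left.2 fun y (hy : U ∈ F ×ˢ 𝓝 y) (hy' : V ∈ F ×ˢ 𝓝 y) =>
        (Filter.nonempty_of_mem (inter_mem hy hy')).ne_empty hd.inter_eq
    have hcover : {y | U ∈ F ×ˢ 𝓝 y} ∪ {y | V ∈ F ×ˢ 𝓝 y} ∈ G := by
      obtain ⟨A, hA, B, hB, hAB⟩ := mem_prod_iff.1 hUV
      filter_upwards [hG.interior_mem B hB] with y hy
      exact (hFG y).mem_or_mem U V hU hV hd
        (mem_of_superset (prod_mem_prod hA (mem_interior_iff_mem_nhds.1 hy)) hAB)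
    rcases hG.mem_or_mem _ _ (isOpen_setOf_mem_prod_nhds F U) (isOpen_setOf_mem_prod_nhds F V)
      hdis hcover with h | h
    · exact .inl (hG.mem_prod_of_eventually_mem hU hV hd hUV h)
    · exact .inr (hG.mem_prod_of_eventually_mem hV hU hd.symm (union_comm U V ▸ hUV) h)

theorem IsTight.nhds_prod [FirstCountableTopology X] [G.NeBot] [G.IsCountablyGenerated]
    (hG : IsTight G) (x : X) : IsTight (𝓝 x ×ˢ G) :=
  hG.prod_of_prod_nhds (isTight_nhds x).interior_mem fun y => nhds_prod_eq (x := x) (y := y) ▸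
    isTight_nhds (x, y)

theorem IsTight.prod_nhds [FirstCountableTopology Y] [F.NeBot] [F.IsCountablyGenerated]
    (hF : IsTight F) (y : Y) : IsTight (F ×ˢ 𝓝 y) := by
  rw [prod_comm']
  exact (hF.nhds_prod y).comap_homeomorph (Homeomorph.prodComm X Y)

theorem IsTight.prod [FirstCountableTopology Y] [F.NeBot] [F.IsCountablyGenerated] [G.NeBot]
    [G.IsCountablyGenerated] (hF : IsTight F) (hG : IsTight G) : IsTight (F ×ˢ G) :=
  hG.prod_of_prod_nhds hF.interior_mem hF.prod_nhds

theorem IsTight.pi {ι : Type*} [Finite ι] {X : ι → Type*} [∀ i, TopologicalSpace (X i)]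
    [∀ i, FirstCountableTopology (X i)] {F : ∀ i, Filter (X i)} [∀ i, (F i).NeBot]
    [∀ i, (F i).IsCountablyGenerated] (hF : ∀ i, IsTight (F i)) : IsTight (Filter.pi F) := by
  induction ι using Finite.induction_empty_option with
  | of_equiv e ih =>
    have h : Filter.pi F = comap (Homeomorph.piCongrLeft e).symm (Filter.pi fun a => F (e a)) := by
      simp [Filter.pi, comap_iInf, comap_comap, Function.comp_def, ← e.iInf_comp]
    exact h ▸ (ih fun a => hF (e a)).comap_homeomorph _
  | h_empty =>
    have : Filter.pi F = 𝓝 isEmptyElim := by simp only [Filter.pi, nhds_pi, iInf_of_empty]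
    exact this ▸ isTight_nhds _
  | @h_option ι _ ih =>
    let e : (∀ i, X i) ≃ₜ X none × ∀ i, X (some i) :=
      { Equiv.piOptionEquivProd with
        continuous_toFun := by dsimp [Equiv.piOptionEquivProd]; fun_prop
        continuous_invFun := continuous_pi fun i => by
          cases i <;> dsimp [Equiv.piOptionEquivProd] <;> fun_prop }
    have h : Filter.pi F = comap e (F none ×ˢ Filter.pi fun i => F (some i)) := by
      simp only [Filter.pi, Filter.prod_eq_inf, comap_inf, comap_iInf, comap_comap, iInf_option]
      rfl
    exact h ▸ ((hF none).prod (ih fun i => hF (some i))).comap_homeomorph e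

end Tight

/-- Two points are *separated in* a set if they lie in different members of a pair of disjoint
open sets covering it; equivalently, they lie in different quasi-components of the set if it
contains both. The covering sets may leave the set, which makes the notion monotone. -/
def IsSeparatedIn {X : Type*} [TopologicalSpace X] (s : Set X) (x y : X) : Prop :=
  ∃ U V : Set X, IsOpen U ∧ IsOpen V ∧ Disjoint U V ∧ s ⊆ U ∪ V ∧ x ∈ U ∧ y ∈ V

section Separation

variable {X Y : Type*} [TopologicalSpace X] [TopologicalSpace Y]

theorem IsSeparatedIn.preimage {f : X → Y} (hf : Continuous f) {s : Set X} {t : Set Y}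
    (hst : MapsTo f s t) {x y : X} (h : IsSeparatedIn t (f x) (f y)) : IsSeparatedIn s x y := by
  obtain ⟨U, V, hU, hV, hd, ht, hx, hy⟩ := h
  exact ⟨_, _, hU.preimage hf, hV.preimage hf, hd.preimage f, fun z hz => ht (hst hz), hx, hy⟩

theorem IsSeparatedIn.symm {s : Set X} {x y : X} (h : IsSeparatedIn s x y) :
    IsSeparatedIn s y x := by
  obtain ⟨U, V, hU, hV, hd, hs, hx, hy⟩ := h
  exact ⟨V, U, hV, hU, hd.symm, union_comm U V ▸ hs, hy, hx⟩

theorem IsSeparatedIn.or_of_mem {s : Set X} {x y z : X} (h : IsSeparatedIn s x z) (hy : y ∈ s) :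
    IsSeparatedIn s x y ∨ IsSeparatedIn s y z := by
  obtain ⟨U, V, hU, hV, hd, hs, hx, hz⟩ := h
  exact (hs hy).symm.imp (fun hyV => ⟨U, V, hU, hV, hd, hs, hx, hyV⟩)
    (fun hyU => ⟨U, V, hU, hV, hd, hs, hyU, hz⟩)

theorem not_isSeparatedIn_self {s : Set X} {x : X} : ¬IsSeparatedIn s x x := by
  rintro ⟨U, V, -, -, hd, -, hxU, hxV⟩
  exact hd.notMem_of_mem_left hxU hxV

theorem not_isSeparatedIn_of_isPreconnected {s t : Set X} (ht : IsPreconnected t) (hts : t ⊆ s)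
    {x y : X} (hx : x ∈ t) (hy : y ∈ t) : ¬IsSeparatedIn s x y := by
  rintro ⟨U, V, hU, hV, hd, hs, hxU, hyV⟩
  obtain ⟨z, -, hz⟩ := ht U V hU hV (hts.trans hs) ⟨x, hx, hxU⟩ ⟨y, hy, hyV⟩
  exact hd.notMem_of_mem_left hz.1 hz.2

theorem isPreconnected_setOf_not_isSeparatedIn {s : Set X} (hs : IsOpen s)
    (hloc : ∀ z ∈ s, ∀ᶠ w in 𝓝 z, ¬IsSeparatedIn s z w) {x : X} (hx : x ∈ s) :
    IsPreconnected {z ∈ s | ¬IsSeparatedIn s x z} := by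
  set Q := {z ∈ s | ¬IsSeparatedIn s x z}
  have hQ : IsOpen Q := isOpen_iff_mem_nhds.2 fun z hz => by
    filter_upwards [hloc z hz.1, hs.mem_nhds hz.1] with w hzw hw
    exact ⟨hw, fun hxw => (hxw.or_of_mem hz.1).elim hz.2 hzw⟩
  have hQc : IsOpen (s \ Q) := isOpen_iff_mem_nhds.2 fun z hz => by
    have hxz : IsSeparatedIn s x z := by_contra fun h => hz.2 ⟨hz.1, h⟩
    filter_upwards [hloc z hz.1, hs.mem_nhds hz.1] with w hzw hw
    exact ⟨hw, fun hwQ => (hxz.or_of_mem hw).elim hwQ.2 fun h => hzw h.symm⟩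
  rintro U V hU hV hQUV ⟨z, hzQ, hzU⟩ ⟨w, hwQ, hwV⟩
  by_contra hne
  have hsep : IsSeparatedIn s z w := by
    refine ⟨Q ∩ U, Q ∩ V ∪ s \ Q, hQ.inter hU, (hQ.inter hV).union hQc, ?_, fun y hy => ?_,
      ⟨hzQ, hzU⟩, .inl ⟨hwQ, hwV⟩⟩
    · refine disjoint_left.2 fun y hy hy' => hy'.elim (fun h => hne ⟨y, hy.1, hy.2, h.2⟩)
        fun h => h.2 hy.1
    · by_cases hyQ : y ∈ Q
      · exact (hQUV hyQ).imp (⟨hyQ, ·⟩) fun h => .inl ⟨hyQ, h⟩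
      · exact .inr (.inr ⟨hy, hyQ⟩)
  exact (hsep.or_of_mem hx).elim (fun h => hzQ.2 h.symm) hwQ.2

theorem isSeparatedIn_of_notMem_image {f : X → ℝ} (hf : Continuous f) {s : Set X} {c : ℝ}
    (hc : c ∉ f '' s) {x y : X} (hx : f x < c) (hy : c < f y) : IsSeparatedIn s x y :=
  ⟨f ⁻¹' Iio c, f ⁻¹' Ioi c, isOpen_Iio.preimage hf, isOpen_Ioi.preimage hf,
    disjoint_left.2 fun z (h : f z < c) => h.asymm,
    fun z hz => lt_or_gt_of_ne fun h => hc ⟨z, hz, h⟩, hx, hy⟩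

theorem exists_isSeparatedIn_of_pi {ι : Type*} [Finite ι] {X : ι → Type*}
    [∀ i, TopologicalSpace (X i)] {s : ∀ i, Set (X i)} {x y : ∀ i, X i}
    (hx : ∀ i, x i ∈ s i) (hy : ∀ i, y i ∈ s i) (h : IsSeparatedIn (univ.pi s) x y) :
    ∃ i, IsSeparatedIn (s i) (x i) (y i) := by
  classical
  have := Fintype.ofFinite ι
  suffices ∀ t : Finset ι, IsSeparatedIn (univ.pi s) (t.piecewise x y) y →
      ∃ i, IsSeparatedIn (s i) (x i) (y i) from
    this Finset.univ (by rwa [Finset.piecewise_univ])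
  intro t
  induction t using Finset.induction_on with
  | empty =>
    rw [Finset.piecewise_empty]
    exact fun h => (not_isSeparatedIn_self h).elim
  | insert i t hi ih =>
    intro hsep
    have hmem (j : ι) : t.piecewise x y j ∈ s j := t.piecewise_cases x y (· ∈ s j) (hx j) (hy j)
    refine (hsep.or_of_mem fun j _ => hmem j).elim (fun h => ⟨i, ?_⟩) ih
    have hupd (z : X i) : Function.update (t.piecewise x y) i z i = z := Function.update_self ..
    refine IsSeparatedIn.preimage (f := Function.update (t.piecewise x y) i) (by fun_prop)
      (t := univ.pi s) (fun z hz j _ => ?_) ?_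
    · rcases eq_or_ne j i with rfl | hj
      · rwa [hupd]
      · rw [Function.update_of_ne hj]
        exact hmem j
    · rwa [← Finset.piecewise_insert, ← Finset.piecewise_eq_of_notMem t x y hi,
        Function.update_eq_self]

theorem exists_isOpen_separating_iUnion {α : Type*} {s : α → Set X} (hs : ∀ n, IsOpen (s n))
    (hd : Pairwise (Function.onFun Disjoint s)) {x y : α → X} (hx : ∀ n, x n ∈ s n)
    (hy : ∀ n, y n ∈ s n) (hsep : ∀ n, IsSeparatedIn (s n) (x n) (y n)) :
    ∃ U V, IsOpen U ∧ IsOpen V ∧ Disjoint U V ∧ ⋃ n, s n ⊆ U ∪ V ∧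
      ∀ n, x n ∈ U ∧ y n ∈ V := by
  choose U V hU hV hUV hsUV hxU hyV using hsep
  refine ⟨⋃ n, s n ∩ U n, ⋃ n, s n ∩ V n, isOpen_iUnion fun n => (hs n).inter (hU n),
    isOpen_iUnion fun n => (hs n).inter (hV n), ?_, ?_, fun n => ⟨?_, ?_⟩⟩
  · refine disjoint_iUnion_left.2 fun m => disjoint_iUnion_right.2 fun n => ?_
    rcases eq_or_ne m n with rfl | hmn
    · exact (hUV m).mono inter_subset_right inter_subset_right
    · exact (hd hmn).mono inter_subset_left inter_subset_left
  · rw [← iUnion_union_distrib]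
    exact iUnion_mono fun n z hz => (hsUV n hz).imp (⟨hz, ·⟩) (⟨hz, ·⟩)
  · exact mem_iUnion_of_mem n ⟨hx n, hxU n⟩
  · exact mem_iUnion_of_mem n ⟨hy n, hyV n⟩

end Separation

theorem isULC_iff {X : Type*} [MetricSpace X] :
    IsULC X ↔ ∀ r > 0, ∀ᶠ q in 𝓤 X, ¬IsSeparatedIn (Metric.ball q.1 r) q.1 q.2 := by
  refine ⟨fun h r hr => ?_, fun h ε hε => ?_⟩
  · obtain ⟨δ, hδ, hC⟩ := h r hr
    filter_upwards [Metric.dist_mem_uniformity hδ] with q hq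
    obtain ⟨C, hCconn, hx, hy, hdiam⟩ := hC q.1 q.2 hq
    refine not_isSeparatedIn_of_isPreconnected hCconn.isPreconnected (fun z hz => ?_) hx hy
    rw [Metric.mem_ball, ← edist_lt_ofReal]
    exact (Metric.edist_le_ediam_of_mem hz hx).trans_lt hdiam
  · have h3 : 0 < ε / 3 := by positivity
    obtain ⟨δ, hδ, hloc⟩ := Metric.mem_uniformity_dist.1 (h (ε / 3) h3)
    refine ⟨min δ (ε / 3), by positivity, fun x y hxy => ?_⟩
    obtain ⟨hxyδ, hxy3⟩ := lt_min_iff.1 hxy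
    have hxB : x ∈ Metric.ball x (ε / 3) := Metric.mem_ball_self h3
    have hnhds : ∀ z ∈ Metric.ball x (ε / 3),
        ∀ᶠ w in 𝓝 z, ¬IsSeparatedIn (Metric.ball x (ε / 3)) z w := fun z hz => by
      filter_upwards [mem_nhds_left z (h _ (sub_pos.2 hz))] with w hw hzw
      exact hw (hzw.preimage continuous_id (Metric.ball_subset_ball' (by simp)))
    refine ⟨{z ∈ Metric.ball x (ε / 3) | ¬IsSeparatedIn (Metric.ball x (ε / 3)) x z},
      ⟨⟨x, hxB, not_isSeparatedIn_self⟩,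
        isPreconnected_setOf_not_isSeparatedIn Metric.isOpen_ball hnhds hxB⟩,
      ⟨hxB, not_isSeparatedIn_self⟩,
      ⟨Metric.mem_ball'.2 hxy3, hloc hxyδ⟩, ?_⟩
    calc Metric.ediam _ ≤ Metric.ediam (Metric.ball x (ε / 3)) := Metric.ediam_mono (sep_subset ..)
      _ ≤ 2 * ENNReal.ofReal (ε / 3) := by
        rw [← Metric.eball_ofReal]; exact Metric.ediam_eball_le
      _ = ENNReal.ofReal (2 * (ε / 3)) := by rw [ENNReal.ofReal_mul two_pos.le]; simp
      _ < ENNReal.ofReal ε := (ENNReal.ofReal_lt_ofReal_iff hε).2 (by linarith)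

theorem exists_mem_Ioo_notMem_iUnion {κ : Type*} [Fintype κ] (S : κ → Set ℝ) {a b : ℝ}
    (hS : ∑ k, Metric.ediam (S k) < ENNReal.ofReal (b - a)) : ∃ c ∈ Ioo a b, c ∉ ⋃ k, S k := by
  refine not_subset.1 fun h => hS.not_ge ?_
  calc ENNReal.ofReal (b - a) = MeasureTheory.volume (Ioo a b) := Real.volume_Ioo.symm
    _ ≤ MeasureTheory.volume (⋃ k, S k) := MeasureTheory.measure_mono h
    _ ≤ ∑ k, MeasureTheory.volume (S k) := MeasureTheory.measure_iUnion_fintype_le _ S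
    _ ≤ ∑ k, Metric.ediam (S k) := Finset.sum_le_sum fun k _ => Real.volume_le_diam (S k)

theorem IsTight.exists_tendsto {X : Type*} [TopologicalSpace X] {F : Filter X} [F.NeBot]
    (hF : IsTight F) {f : X → ℝ} (hf : Continuous f)
    (hlim : ∀ 𝒰 : Ultrafilter X, 𝒰 ≤ F → ∃ a, Tendsto f 𝒰 (𝓝 a))
    (hgap : ∀ a b, a < b → ∃ A ∈ F, ∃ c ∈ Ioo a b, c ∉ f '' A) : ∃ a, Tendsto f F (𝓝 a) := by
  have hle {𝒰 𝒱 : Ultrafilter X} (h𝒰 : 𝒰 ≤ F) (h𝒱 : 𝒱 ≤ F) {a b : ℝ}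
      (ha : Tendsto f 𝒰 (𝓝 a)) (hb : Tendsto f 𝒱 (𝓝 b)) : b ≤ a := by
    by_contra! hab
    obtain ⟨A, hA, c, hc, hcA⟩ := hgap a b hab
    have hcover : f ⁻¹' Iio c ∪ f ⁻¹' Ioi c ∈ F :=
      mem_of_superset hA fun z hz => lt_or_gt_of_ne fun h => hcA ⟨z, hz, h⟩
    rcases hF.mem_or_mem _ _ (isOpen_Iio.preimage hf) (isOpen_Ioi.preimage hf)
      (disjoint_left.2 fun z (h : f z < c) => h.asymm) hcover with h | h
    · obtain ⟨z, hz, hz'⟩ := ((hb.eventually (lt_mem_nhds hc.2)).and (h𝒱 h)).exists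
      exact hz.asymm hz'
    · obtain ⟨z, hz, hz'⟩ := ((ha.eventually (gt_mem_nhds hc.1)).and (h𝒰 h)).exists
      exact hz.asymm hz'
  obtain ⟨a, ha⟩ := hlim (.of F) (Ultrafilter.of_le F)
  refine ⟨a, (tendsto_iff_ultrafilter _ _ _).2 fun 𝒰 h𝒰 => ?_⟩
  obtain ⟨b, hb⟩ := hlim 𝒰 h𝒰
  rwa [(hle (Ultrafilter.of_le F) h𝒰 ha hb).antisymm (hle h𝒰 (Ultrafilter.of_le F) hb ha)] at hb

section UniformGap

variable {X κ : Type*} [UniformSpace X] [Finite κ] {C : κ → Set X} {f : X → ℝ}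

theorem exists_mem_uniformity_forall_exists_notMem_image (hC : ⋃ k, C k = univ)
    (hf : ∀ k, UniformContinuousOn f (C k)) {ε : ℝ} (hε : 0 < ε) :
    ∃ D ∈ 𝓤 X, ∀ A : Set X, A ×ˢ A ⊆ D → ∀ a b, ε ≤ b - a → ∃ c ∈ Ioo a b, c ∉ f '' A := by
  have := Fintype.ofFinite κ
  obtain ⟨η, hη, hηε⟩ : ∃ η > 0, Fintype.card κ * η < ε := by
    refine ⟨ε / (Fintype.card κ + 1), by positivity, ?_⟩
    rw [mul_div_assoc', div_lt_iff₀ (by positivity)]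
    linarith
  have hD : ∀ᶠ q in 𝓤 X, ∀ k, q.1 ∈ C k → q.2 ∈ C k → dist (f q.1) (f q.2) < η :=
    eventually_all.2 fun k => by
      filter_upwards [eventually_inf_principal.1 (hf k (Metric.dist_mem_uniformity hη))]
        with q hq h1 h2 using hq ⟨h1, h2⟩
  refine ⟨_, hD, fun A hA a b hab => ?_⟩
  have hdiam (k : κ) : Metric.ediam (f '' (A ∩ C k)) ≤ ENNReal.ofReal η := by
    refine Metric.ediam_le ?_
    rintro _ ⟨x, ⟨hxA, hxC⟩, rfl⟩ _ ⟨y, ⟨hyA, hyC⟩, rfl⟩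
    rw [edist_dist]
    exact ENNReal.ofReal_le_ofReal (hA (mk_mem_prod hxA hyA) k hxC hyC).le
  have hsum : ∑ k, Metric.ediam (f '' (A ∩ C k)) < ENNReal.ofReal (b - a) :=
    calc ∑ k, Metric.ediam (f '' (A ∩ C k)) ≤ ∑ _ : κ, ENNReal.ofReal η :=
          Finset.sum_le_sum fun k _ => hdiam k
      _ = ENNReal.ofReal (Fintype.card κ * η) := by
          simp [ENNReal.ofReal_mul]
      _ < ENNReal.ofReal (b - a) :=
          (ENNReal.ofReal_lt_ofReal_iff (hε.trans_le hab)).2 (hηε.trans_le hab)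
  rw [← inter_univ A, ← hC, inter_iUnion, image_iUnion]
  exact exists_mem_Ioo_notMem_iUnion _ hsum

theorem exists_tendsto_of_forall_uniformContinuousOn (hC : ⋃ k, C k = univ)
    (hf : ∀ k, UniformContinuousOn f (C k)) {𝒰 : Ultrafilter X} (h𝒰 : Cauchy (𝒰 : Filter X)) :
    ∃ a, Tendsto f 𝒰 (𝓝 a) := by
  obtain ⟨k, hk⟩ : ∃ k, ∀ᶠ x in (𝒰 : Filter X), x ∈ C k :=
    Ultrafilter.eventually_exists_iff.1 (.of_forall fun x => mem_iUnion.1 (hC ▸ mem_univ x))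
  refine CompleteSpace.complete ⟨inferInstance, ?_⟩
  rw [prod_map_map_eq]
  exact (hf k).mono_left (le_inf h𝒰.2 (le_principal_iff.2 (prod_mem_prod hk hk)))

theorem IsTight.exists_tendsto_of_uniformContinuousOn {F : Filter X} (hF : IsTight F)
    (hFc : Cauchy F) (hC : ⋃ k, C k = univ) (hf : Continuous f)
    (hfC : ∀ k, UniformContinuousOn f (C k)) : ∃ a, Tendsto f F (𝓝 a) := by
  have := hFc.1
  have hlim (𝒰 : Ultrafilter X) (h𝒰 : 𝒰 ≤ F) : ∃ a, Tendsto f 𝒰 (𝓝 a) :=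
    exists_tendsto_of_forall_uniformContinuousOn hC hfC (hFc.mono h𝒰)
  refine hF.exists_tendsto hf hlim fun a b hab => ?_
  obtain ⟨D, hD, hgap⟩ :=
    exists_mem_uniformity_forall_exists_notMem_image hC hfC (sub_pos.2 hab)
  obtain ⟨A, hA, hAD⟩ := (cauchy_iff.1 hFc).2 D hD
  exact ⟨A, hA, hgap A hAD a b le_rfl⟩

end UniformGap

section Trace

/-- The trace on a uniform space of the neighbourhood filter of a point of its completion. It is
the minimal Cauchy filter converging to that point. -/
def completionTrace {X : Type*} [UniformSpace X] (p : Completion X) : Filter X :=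
  comap (↑) (𝓝 p)

variable {X : Type*} [UniformSpace X]

instance (p : Completion X) : (completionTrace p).NeBot :=
  Completion.isDenseInducing_coe.comap_nhds_neBot p

instance {X : Type*} [MetricSpace X] (p : Completion X) :
    (completionTrace p).IsCountablyGenerated :=
  inferInstanceAs (comap _ _).IsCountablyGenerated

theorem cauchy_completionTrace (p : Completion X) : Cauchy (completionTrace p) :=
  (Completion.isUniformInducing_coe X).cauchy_map_iff.1 (cauchy_nhds.mono map_comap_le)

theorem interior_mem_completionTrace {p : Completion X} {s : Set X}
    (hs : s ∈ completionTrace p) : interior s ∈ completionTrace p := by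
  obtain ⟨t, ht, hts⟩ := mem_comap.1 hs
  refine mem_of_superset (preimage_mem_comap (interior_mem_nhds.2 ht)) ?_
  exact interior_maximal ((preimage_mono interior_subset).trans hts)
    (isOpen_interior.preimage (Completion.continuous_coe X))

theorem exists_le_completionTrace {F : Filter X} (hF : Cauchy F) :
    ∃ p, F ≤ completionTrace p := by
  obtain ⟨p, hp⟩ := CompleteSpace.complete (hF.map (Completion.uniformContinuous_coe X))
  exact ⟨p, map_le_iff_le_comap.1 hp⟩

end Trace

section Straight

variable {X : Type*} [MetricSpace X]

theorem IsStraight.uniformContinuous_of_union (hX : IsStraight X) {A B : Set X} (hA : IsClosed A)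
    (hB : IsClosed B) (hAB : A ∪ B = univ) {f : X → ℝ} (hfA : UniformContinuousOn f A)
    (hfB : UniformContinuousOn f B) : UniformContinuous f := by
  have hf : Continuous f := by
    rw [← continuousOn_univ, ← hAB]
    exact hfA.continuousOn.union_of_isClosed hfB.continuousOn hA hB
  refine (hX 2 ![A, B] ?_ ?_ ⟨f, hf⟩).2 ?_
  · exact Fin.forall_fin_two.2 ⟨hA, hB⟩
  · rw [← hAB]
    exact eq_of_forall_ge_iff fun s => iUnion_subset_iff.trans
      (Fin.forall_fin_two.trans union_subset_iff.symm)
  · exact Fin.forall_fin_two.2 ⟨hfA, hfB⟩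

theorem IsStraight.eventually_le_of_isOpen (hX : IsStraight X) {g : X → ℝ}
    (hg : UniformContinuous g) {U V : Set X} (hU : IsOpen U) (hV : IsOpen V) (hUV : Disjoint U V)
    {r s : ℝ} (hsr : s < r) (hcover : ∀ z, g z < r → z ∈ U ∪ V) :
    ∀ᶠ q in 𝓤 X, q.1 ∈ U → q.2 ∈ V → s ≤ g q.1 := by
  obtain ⟨b, hsb, hbr⟩ := exists_between hsr
  -- Truncating `b - g` to `U` makes a jump of size `b - g q.1` between `q.1 ∈ U` and `q.2 ∈ V`.
  let f : X → ℝ := (U ∩ {z | g z < b}).indicator (b - g ·)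
  have hf_sub {z : X} (hz : z ∈ U) (hzb : g z < b) : f z = b - g z := by simp [f, hz, hzb]
  have hf_zero {z : X} (hz : z ∈ U → b ≤ g z) : f z = 0 := by simp +contextual [f, hz]
  have hfA : UniformContinuousOn f ({z | b ≤ g z} ∪ Uᶜ) :=
    (uniformContinuous_const (b := (0 : ℝ))).uniformContinuousOn.congr fun z hz =>
      (hf_zero fun hzU => hz.resolve_right (not_not.2 hzU)).symm
  have hfB : UniformContinuousOn f ({z | g z ≤ b} \ V) :=
    ((uniformContinuous_const (b := b)).sub hg).uniformContinuousOn.congr fun z hz => by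
      have hzU : z ∈ U := (hcover z (hz.1.trans_lt hbr)).resolve_right hz.2
      rcases (show g z ≤ b from hz.1).lt_or_eq with h | h
      · exact (hf_sub hzU h).symm
      · exact (sub_eq_zero.2 h.symm).trans (hf_zero fun _ => h.ge).symm
  have hf : UniformContinuous f := by
    refine hX.uniformContinuous_of_union ?_ ?_ (eq_univ_of_forall fun z => ?_) hfA hfB
    · exact (isClosed_le continuous_const hg.continuous).union hU.isClosed_compl
    · exact (isClosed_le hg.continuous continuous_const).sdiff hV
    · refine or_iff_not_imp_left.2 fun hz => ?_
      obtain ⟨hzb, hzU⟩ := not_or.1 hz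
      exact ⟨show g z ≤ b from (not_le.1 hzb).le, disjoint_left.1 hUV (not_not.1 hzU)⟩
  filter_upwards [hf (Metric.dist_mem_uniformity (sub_pos.2 hsb))] with q hq hqU hqV
  by_contra! hqs
  have hfq : dist (f q.1) (f q.2) < b - s := hq
  rw [hf_sub hqU (hqs.trans hsb), hf_zero fun h => (disjoint_left.1 hUV h hqV).elim,
    Real.dist_0_eq_abs] at hfq
  linarith [le_abs_self (b - g q.1)]

theorem IsStraight.isTight_completionTrace (hX : IsStraight X) (p : Completion X) :
    IsTight (completionTrace p) where
  interior_mem _ := interior_mem_completionTrace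
  mem_or_mem U V hU hV hd hUV := by
    by_contra! hn
    obtain ⟨t, ht, htUV⟩ := mem_comap.1 hUV
    obtain ⟨r, hr, hrt⟩ := Metric.mem_nhds_iff.1 ht
    have hUfr : ∃ᶠ z in completionTrace p, z ∈ U := fun h =>
      hn.2 (by filter_upwards [h, hUV] with z hz hzUV using hzUV.resolve_left hz)
    have hVfr : ∃ᶠ z in completionTrace p, z ∈ V := fun h =>
      hn.1 (by filter_upwards [h, hUV] with z hz hzUV using hzUV.resolve_right hz)
    have hfar : ∀ᶠ q in 𝓤 X, q.1 ∈ U → q.2 ∈ V → r / 2 ≤ dist (q.1 : Completion X) p :=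
      hX.eventually_le_of_isOpen
        ((Completion.uniformContinuous_coe X).dist uniformContinuous_const) hU hV hd
        (half_lt_self hr) fun z hz => htUV (hrt hz)
    have hnear : ∀ᶠ q : X × X in completionTrace p ×ˢ completionTrace p,
        dist (q.1 : Completion X) p < r / 2 :=
      tendsto_fst.eventually (preimage_mem_comap (Metric.ball_mem_nhds p (half_pos hr)))
    have hfar' := hfar.filter_mono (cauchy_completionTrace p).2
    obtain ⟨q, ⟨hqU, hqV⟩, hqfar, hqnear⟩ :=
      ((frequently_prod_and.2 ⟨hUfr, hVfr⟩).and_eventually (hfar'.and hnear)).exists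
    exact (hqfar hqU hqV).not_gt hqnear

/-- Points that are uniformly close together but separated in balls of a fixed radius can only be
found along Cauchy filters. Both uniformly locally connected spaces and precompact spaces have this
property. -/
def HasCauchySeparation (X : Type*) [MetricSpace X] : Prop :=
  ∀ r > 0, ∀ 𝒢 : Ultrafilter (X × X), 𝒢 ≤ 𝓤 X →
    (∀ᶠ q in (𝒢 : Filter (X × X)), IsSeparatedIn (Metric.ball q.1 r) q.1 q.2) →
      Cauchy (map Prod.fst (𝒢 : Filter (X × X)))

theorem exists_forall_ball_notMem {F : Filter X} [F.NeBot] (hF : ¬Cauchy F) :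
    ∃ ε > 0, ∀ x, Metric.ball x ε ∉ F := by
  contrapose! hF
  refine Metric.cauchy_iff.2 ⟨‹_›, fun ε hε => ?_⟩
  obtain ⟨x, hx⟩ := hF (ε / 2) (half_pos hε)
  exact ⟨_, hx, fun y hy z hz => by
    linarith [dist_triangle_right y z x, Metric.mem_ball.1 hy, Metric.mem_ball.1 hz]⟩

theorem exists_seq_tendsto_uniformity_of_ball_notMem {𝒢 : Ultrafilter (X × X)} (h𝒢 : 𝒢 ≤ 𝓤 X)
    {ε : ℝ} (hball : ∀ x, Metric.ball x ε ∉ map Prod.fst (𝒢 : Filter (X × X)))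
    {P : X × X → Prop} (hP : ∀ᶠ q in (𝒢 : Filter (X × X)), P q) (hne : ∀ q, P q → q.1 ≠ q.2) :
    ∃ q : ℕ → X × X, Tendsto q atTop (𝓤 X) ∧ (∀ n, P (q n)) ∧
      Pairwise fun m n => ε ≤ dist (q m).1 (q n).1 := by
  obtain ⟨q, hqP, hq⟩ := exists_seq_of_forall_finset_exists P
    (fun a b => ε ≤ dist a.1 b.1 ∧ dist b.1 b.2 ≤ 1 / 2 * dist a.1 a.2) fun s hs => by
      have hs' : ∀ᶠ b in (𝒢 : Filter (X × X)),
          ∀ a ∈ s, ε ≤ dist a.1 b.1 ∧ dist b.1 b.2 ≤ 1 / 2 * dist a.1 a.2 := by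
        refine s.eventually_all.2 fun a ha => ?_
        have hpos : 0 < dist a.1 a.2 := dist_pos.2 (hne a (hs a ha))
        filter_upwards [Ultrafilter.compl_mem_iff_notMem.2 (hball a.1),
          h𝒢 (Metric.dist_mem_uniformity (half_pos hpos))] with b hb hb'
        exact ⟨by simpa [dist_comm] using hb, by simpa [div_eq_inv_mul] using le_of_lt hb'⟩
      exact (hP.and hs').exists
  refine ⟨q, tendsto_uniformity_iff_dist_tendsto_zero.2 ?_, hqP, fun m n hmn => ?_⟩
  · refine squeeze_zero (fun _ => dist_nonneg) (fun n =>
      le_geom (u := fun n => dist (q n).1 (q n).2) one_half_pos.le n fun k _ =>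
        (hq k (k + 1) k.lt_succ_self).2) ?_
    simpa using (tendsto_pow_atTop_nhds_zero_of_lt_one (r := (1 / 2 : ℝ)) (by norm_num)
      (by norm_num)).mul_const _
  · rcases hmn.lt_or_gt with h | h
    · exact (hq m n h).1
    · exact dist_comm (q n).1 _ ▸ (hq n m h).1

theorem IsStraight.hasCauchySeparation (hX : IsStraight X) : HasCauchySeparation X := by
  intro r hr 𝒢 h𝒢 hsep
  by_contra hC
  obtain ⟨ε, hε, hball⟩ := exists_forall_ball_notMem hC
  set ρ := min (ε / 2) r
  have hρ0 : 0 < ρ := by positivity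
  obtain ⟨q, hq, hqsep, hqdist⟩ := exists_seq_tendsto_uniformity_of_ball_notMem h𝒢 hball
    (P := fun q => IsSeparatedIn (Metric.ball q.1 r) q.1 q.2 ∧ dist q.1 q.2 < ρ)
    (hsep.and (h𝒢 (Metric.dist_mem_uniformity hρ0)))
    fun q hq h => not_isSeparatedIn_self (h ▸ hq.1)
  obtain ⟨U, V, hU, hV, hd, hUV, hqUV⟩ := exists_isOpen_separating_iUnion
    (s := fun n => Metric.ball (q n).1 ρ) (fun _ => Metric.isOpen_ball)
    (fun m n hmn => Metric.ball_disjoint_ball ((by linarith [min_le_left (ε / 2) r] :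
      ρ + ρ ≤ ε).trans (hqdist hmn)))
    (fun n => Metric.mem_ball_self hρ0) (fun n => Metric.mem_ball'.2 (hqsep n).2)
    fun n => (hqsep n).1.preimage continuous_id (Metric.ball_subset_ball (min_le_right _ _))
  have hfar : ∀ᶠ z in 𝓤 X, z.1 ∈ U → z.2 ∈ V →
      ρ / 2 ≤ Metric.infDist z.1 (range fun n => (q n).1) := by
    refine hX.eventually_le_of_isOpen (Metric.uniformContinuous_infDist_pt _) hU hV hd
      (half_lt_self hρ0) fun z hz => hUV ?_
    obtain ⟨_, ⟨n, rfl⟩, hn⟩ := (Metric.infDist_lt_iff (range_nonempty _)).1 hz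
    exact mem_iUnion_of_mem n hn
  obtain ⟨n, hn⟩ := (hq.eventually hfar).exists
  have hzero : Metric.infDist (q n).1 (range fun n => (q n).1) = 0 :=
    Metric.infDist_zero_of_mem (mem_range_self n)
  exact (half_pos hρ0).not_ge (hzero ▸ hn (hqUV n).1 (hqUV n).2)

theorem exists_isSeparatedIn_ball_of_le_dist {κ : Type*} [Finite κ] {C : κ → Set X}
    (hC : ⋃ k, C k = univ) {f : X → ℝ} (hf : Continuous f)
    (hfC : ∀ k, UniformContinuousOn f (C k)) {ε : ℝ} (hε : 0 < ε) :
    ∃ r > 0, ∀ x y, ε ≤ dist (f x) (f y) → IsSeparatedIn (Metric.ball x r) x y := by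
  obtain ⟨D, hD, hgap⟩ := exists_mem_uniformity_forall_exists_notMem_image hC hfC hε
  obtain ⟨δ, hδ, hδD⟩ := Metric.mem_uniformity_dist.1 hD
  have hball (x : X) : Metric.ball x (δ / 2) ×ˢ Metric.ball x (δ / 2) ⊆ D := fun q hq => by
    refine hδD ?_
    linarith [dist_triangle_right q.1 q.2 x, Metric.mem_ball.1 hq.1, Metric.mem_ball.1 hq.2]
  refine ⟨δ / 2, half_pos hδ, fun x y hxy => ?_⟩
  rcases le_abs'.1 (Real.dist_eq (f x) (f y) ▸ hxy) with h | h
  · obtain ⟨c, hc, hcA⟩ := hgap _ (hball x) (f x) (f y) (by linarith)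
    exact isSeparatedIn_of_notMem_image hf hcA hc.1 hc.2
  · obtain ⟨c, hc, hcA⟩ := hgap _ (hball x) (f y) (f x) h
    exact (isSeparatedIn_of_notMem_image hf hcA hc.1 hc.2).symm

theorem IsStraight.of_isTight (htight : ∀ p, IsTight (completionTrace (X := X) p))
    (hsep : HasCauchySeparation X) : IsStraight X := by
  refine fun m C _ hC f => ⟨fun h k => h.uniformContinuousOn, fun hfC => ?_⟩
  by_contra hf
  obtain ⟨ε, hε, hfar⟩ : ∃ ε > 0, ∃ᶠ q in 𝓤 X, ε ≤ dist (f q.1) (f q.2) := by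
    contrapose! hf
    exact Metric.uniformity_basis_dist.tendsto_right_iff.2 fun ε hε => by simpa using hf ε hε
  obtain ⟨r, hr, hr_sep⟩ := exists_isSeparatedIn_ball_of_le_dist hC f.continuous hfC hε
  have : (𝓤 X ⊓ 𝓟 {q | ε ≤ dist (f q.1) (f q.2)}).NeBot := frequently_iff_neBot.1 hfar
  obtain ⟨𝒢, h𝒢⟩ := Ultrafilter.exists_le (𝓤 X ⊓ 𝓟 {q | ε ≤ dist (f q.1) (f q.2)})
  have h𝒢far : ∀ᶠ q in (𝒢 : Filter (X × X)), ε ≤ dist (f q.1) (f q.2) :=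
    le_principal_iff.1 (h𝒢.trans inf_le_right)
  have hcauchy := hsep r hr 𝒢 (h𝒢.trans inf_le_left) (h𝒢far.mono fun q => hr_sep q.1 q.2)
  obtain ⟨p, hp⟩ := exists_le_completionTrace hcauchy
  obtain ⟨a, ha⟩ := (htight p).exists_tendsto_of_uniformContinuousOn (cauchy_completionTrace p) hC
    f.continuous hfC
  have hfst : Tendsto Prod.fst (𝒢 : Filter (X × X)) (completionTrace p) := hp
  have hsnd : Tendsto Prod.snd (𝒢 : Filter (X × X)) (completionTrace p) :=
    tendsto_comap_iff.2 ((tendsto_comap_iff.1 hfst).congr_uniformity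
      ((Completion.uniformContinuous_coe X).mono_left (h𝒢.trans inf_le_left)))
  have hzero : Tendsto (fun q : X × X => dist (f q.1) (f q.2)) 𝒢 (𝓝 0) := by
    simpa using (ha.comp hfst).dist (ha.comp hsnd)
  exact hε.not_ge (ge_of_tendsto hzero h𝒢far)

theorem IsStraight.of_leftInverse {Y : Type*} [MetricSpace Y] (hX : IsStraight X) {ρ : X → Y}
    {s : Y → X} (hρ : UniformContinuous ρ) (hs : UniformContinuous s)
    (h : Function.LeftInverse ρ s) : IsStraight Y := by
  refine fun m C hC hCU f => ⟨fun hf k => hf.uniformContinuousOn, fun hf => ?_⟩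
  have hfρ : UniformContinuous (f ∘ ρ) := by
    refine (hX m (fun k => ρ ⁻¹' C k) (fun k => (hC k).preimage hρ.continuous) ?_
      ⟨f ∘ ρ, f.continuous.comp hρ.continuous⟩).2 fun k =>
        (hf k).comp hρ.uniformContinuousOn (mapsTo_preimage ρ _)
    rw [← preimage_iUnion, hCU, preimage_univ]
  simpa [Function.comp_assoc, h.comp_eq_id] using hfρ.comp hs

end Straight

section Product

theorem tendsto_completionTrace {X Y : Type*} [UniformSpace X] [UniformSpace Y] {f : X → Y}
    (hf : UniformContinuous f) (p : Completion X) :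
    Tendsto f (completionTrace p) (completionTrace (Completion.map f p)) := by
  refine tendsto_comap_iff.2 ?_
  have hcoe : (↑) ∘ f = Completion.map f ∘ ((↑) : X → Completion X) :=
    funext fun x => (Completion.map_coe hf x).symm
  rw [hcoe]
  exact Completion.continuous_map.continuousAt.tendsto.comp tendsto_comap

theorem le_completionTrace_of_cauchy {X : Type*} [UniformSpace X] {F : Filter X} (hF : Cauchy F)
    {p : Completion X} (h : completionTrace p ≤ F) : F ≤ completionTrace p := by
  refine map_le_iff_le_comap.1 (le_nhds_of_cauchy_adhp
    (hF.map (Completion.uniformContinuous_coe X)) ?_)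
  exact (inferInstance : (map (↑) (completionTrace p)).NeBot).mono
    (le_inf map_comap_le (map_mono h))

theorem completionTrace_pi {ι : Type*} {X : ι → Type*} [∀ i, UniformSpace (X i)]
    (p : Completion (∀ i, X i)) :
    completionTrace p =
      Filter.pi fun i => completionTrace (Completion.map (Function.eval i) p) := by
  have hle : completionTrace p ≤
      Filter.pi fun i => completionTrace (Completion.map (Function.eval i) p) :=
    le_pi.2 fun i => tendsto_completionTrace (Pi.uniformContinuous_proj X i) p
  have hcauchy : Cauchy (Filter.pi fun i => completionTrace (Completion.map (Function.eval i) p)) :=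
    (cauchy_pi_iff' X).2 fun i => (cauchy_completionTrace _).mono (tendsto_eval_pi _ i)
  exact hle.antisymm (le_completionTrace_of_cauchy hcauchy hle)

variable {ι : Type*} [Fintype ι] {X : ι → Type*} [∀ i, MetricSpace (X i)]

theorem HasCauchySeparation.pi (hsep : ∀ i, HasCauchySeparation (X i))
    (h : ∀ i j, i ≠ j → IsPrecompactSpace (X i) ∨ IsULC (X j)) :
    HasCauchySeparation (∀ i, X i) := by
  intro r hr 𝒢 h𝒢 h𝒢sep
  obtain ⟨j, hj⟩ : ∃ j, ∀ᶠ q in (𝒢 : Filter ((∀ i, X i) × ∀ i, X i)),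
      IsSeparatedIn (Metric.ball (q.1 j) r) (q.1 j) (q.2 j) := by
    refine Ultrafilter.eventually_exists_iff.1 ?_
    filter_upwards [h𝒢sep, h𝒢 (Metric.dist_mem_uniformity hr)] with q hq hdist
    rw [ball_pi _ hr] at hq
    exact exists_isSeparatedIn_of_pi (fun i => Metric.mem_ball_self hr)
      (fun i => Metric.mem_ball'.2 ((dist_le_pi_dist q.1 q.2 i).trans_lt hdist)) hq
  have h𝒢j : Tendsto (Prod.map (Function.eval j) (Function.eval j)) 𝒢 (𝓤 (X j)) :=
    (Pi.uniformContinuous_proj X j).mono_left h𝒢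
  have hULC : ¬IsULC (X j) := fun hULC =>
    let ⟨_, hq, hq'⟩ := (hj.and (h𝒢j.eventually (isULC_iff.1 hULC r hr))).exists
    hq' hq
  refine (cauchy_pi_iff' X).2 fun i => ?_
  rcases eq_or_ne i j with rfl | hij
  · exact hsep i r hr (𝒢.map (Prod.map (Function.eval i) (Function.eval i))) h𝒢j hj
  · exact ((𝒢.map Prod.fst).map (Function.eval i)).cauchy_of_totallyBounded
      ((h i j hij).resolve_right hULC) (le_principal_iff.2 univ_mem)

theorem HasCauchySeparation.isPrecompactSpace_or_isULC [∀ i, Nonempty (X i)]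
    (h : HasCauchySeparation (∀ i, X i)) {i j : ι} (hij : i ≠ j) :
    IsPrecompactSpace (X i) ∨ IsULC (X j) := by
  classical
  refine or_iff_not_imp_right.2 fun hULC => totallyBounded_iff_ultrafilter.2 fun 𝒰 _ => ?_
  obtain ⟨r, hr, hfreq⟩ : ∃ r > 0, ∃ᶠ q in 𝓤 (X j), IsSeparatedIn (Metric.ball q.1 r) q.1 q.2 := by
    simpa [isULC_iff] using hULC
  obtain ⟨𝒱, h𝒱⟩ := exists_ultrafilter_iff.2 (frequently_iff_neBot.1 hfreq)
  obtain ⟨h𝒱_unif, h𝒱_sep⟩ := le_inf_iff.1 h𝒱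
  let x₀ : ∀ i, X i := fun i => Classical.arbitrary (X i)
  let e (a : X i) (b : X j) : ∀ i, X i := Function.update (Function.update x₀ i a) j b
  let g (t : X i × X j × X j) : (∀ i, X i) × ∀ i, X i := (e t.1 t.2.1, e t.1 t.2.2)
  let 𝒲 : Ultrafilter (X i × X j × X j) := .of (𝒰 ×ˢ 𝒱)
  have h𝒲 : (𝒲 : Filter (X i × X j × X j)) ≤ (𝒰 : Filter (X i)) ×ˢ (𝒱 : Filter (X j × X j)) :=
    Ultrafilter.of_le _
  have hfst : Tendsto Prod.fst (𝒲 : Filter (X i × X j × X j)) (𝒰 : Filter (X i)) :=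
    tendsto_fst.mono_left h𝒲
  have hsnd : Tendsto Prod.snd (𝒲 : Filter (X i × X j × X j)) (𝒱 : Filter (X j × X j)) :=
    tendsto_snd.mono_left h𝒲
  have hunif : Tendsto g 𝒲 (𝓤 (∀ i, X i)) := by
    refine Metric.uniformity_basis_dist.tendsto_right_iff.2 fun ε hε => ?_
    filter_upwards [hsnd.eventually (h𝒱_unif (Metric.dist_mem_uniformity hε))] with t ht
    refine (dist_pi_lt_iff hε).2 fun k => ?_
    rcases eq_or_ne k j with rfl | hk
    · simpa [g, e] using ht
    · simpa [g, e, hk] using hε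
  have hsep : ∀ᶠ t in (𝒲 : Filter _), IsSeparatedIn (Metric.ball (g t).1 r) (g t).1 (g t).2 := by
    filter_upwards [hsnd.eventually (le_principal_iff.1 h𝒱_sep)] with t ht
    refine IsSeparatedIn.preimage (f := Function.eval j) (continuous_apply j)
      (t := Metric.ball t.2.1 r) (fun z hz => ?_) (by simpa [g, e] using ht)
    simpa [g, e] using (dist_le_pi_dist z (g t).1 j).trans_lt hz
  have hcauchy : Cauchy (map Prod.fst (map g (𝒲 : Filter _))) := h r hr (𝒲.map g) hunif hsep
  have hi (t : X i × X j × X j) : (g t).1 i = t.1 := by simp [g, e, hij]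
  have hmap : map (Function.eval i) (map Prod.fst (map g (𝒲 : Filter _))) = 𝒰 := by
    rw [map_map, map_map, ← 𝒰.unique hfst]
    exact map_congr (.of_forall hi)
  exact hmap ▸ hcauchy.map (Pi.uniformContinuous_proj X i)

theorem forall_ne_or_iff {ι : Type*} (P Q : ι → Prop) :
    (∀ i j, i ≠ j → P i ∨ Q j) ↔ (∀ i, P i) ∨ (∀ i, Q i) ∨ ∃ j, ∀ i, i ≠ j → P i ∧ Q i := by
  refine ⟨fun h => ?_, ?_⟩
  · by_contra! ⟨⟨i, hi⟩, ⟨j, hj⟩, hn⟩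
    obtain rfl : i = j := by
      by_contra hij
      exact (h i j hij).elim hi hj
    obtain ⟨k, hk, hkn⟩ := hn i
    exact hkn ((h k i hk).resolve_right hj) ((h i k hk.symm).resolve_left hi)
  · rintro (h | h | ⟨k, h⟩) i j hij
    · exact Or.inl (h i)
    · exact Or.inr (h j)
    · rcases eq_or_ne i k with rfl | hi
      · exact Or.inr (h j hij.symm).2
      · exact Or.inl (h i hi).1

theorem isStraight_pi_iff [∀ i, Nonempty (X i)] :
    IsStraight (∀ i, X i) ↔
      (∀ i, IsStraight (X i)) ∧
        ∀ i j, i ≠ j → IsPrecompactSpace (X i) ∨ IsULC (X j) := by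
  classical
  refine ⟨fun h => ⟨fun i => ?_, fun i j => h.hasCauchySeparation.isPrecompactSpace_or_isULC⟩,
    fun ⟨h, hpair⟩ => IsStraight.of_isTight (fun p => ?_)
      (.pi (fun i => (h i).hasCauchySeparation) hpair)⟩
  · refine h.of_leftInverse (Pi.uniformContinuous_proj X i)
      (s := Function.update (fun i => Classical.arbitrary (X i)) i) ?_ fun z => by simp
    refine uniformContinuous_pi.2 fun j => ?_
    rcases eq_or_ne j i with rfl | hj
    · simp only [Function.update_self]
      exact uniformContinuous_id
    · simpa [hj] using uniformContinuous_const
  · rw [completionTrace_pi]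
    exact .pi fun i => (h i).isTight_completionTrace _

end Product

theorem corollary1_general {ι : Type*} [Fintype ι] (p : ℝ≥0∞) [Fact (1 ≤ p)] (X : ι → Type*)
    [∀ i, MetricSpace (X i)] [∀ i, Nonempty (X i)] :
    IsStraight (PiLp p X) ↔
      (∀ i, IsStraight (X i)) ∧
        ((∀ i, IsPrecompactSpace (X i)) ∨
          (∀ i, IsULC (X i)) ∨
          (∃ j, ∀ i, i ≠ j → IsPrecompactSpace (X i) ∧ IsULC (X i))) := by
  let e := PiLp.uniformEquiv p X
  rw [← forall_ne_or_iff (fun i => IsPrecompactSpace (X i)) fun i => IsULC (X i),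
    ← isStraight_pi_iff]
  exact ⟨fun h => h.of_leftInverse e.uniformContinuous e.symm.uniformContinuous e.right_inv,
    fun h => h.of_leftInverse e.symm.uniformContinuous e.uniformContinuous e.left_inv⟩

/-- The product carries the sum metric `d(x, y) = ∑ i, d_i(x i, y i)`, i.e. it is `PiLp 1 X`. -/
theorem corollary1 {n : ℕ} (X : Fin n → Type*) [∀ i, MetricSpace (X i)] [∀ i, Nonempty (X i)] :
    IsStraight (PiLp 1 X) ↔
      (∀ i, IsStraight (X i)) ∧
        ((∀ i, IsPrecompactSpace (X i)) ∨
          (∀ i, IsULC (X i)) ∨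
          (∃ j, ∀ i, i ≠ j → IsPrecompactSpace (X i) ∧ IsULC (X i))) :=
  corollary1_general 1 X
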